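/- Let $\mathbb{M}_{n_1,n_2}$ be the space of $n_1\times n_2$ matrices with real or complex entries, with the Frobenius norm $\|X\|$ and the real Frobenius inner product $\operatorname{Re}\operatorname{tr}(X^*Y)$. Let $\mathcal{H}$ be a finite-dimensional real inner product space (for instance $\mathbb{R}^m$, or $\mathbb{C}^m$ with the real part of its inner product), let $\mathcal{A}:\mathbb{M}_{n_1,n_2}\to\mathcal{H}$ be a (real-)linear map with adjoint $\mathcal{A}^*$, let $b\in\mathcal{H}$ and let $K\ge 1$ be an integer. Put $\iota_{R_K}(X)=0$ if $\operatorname{rank}(X)\le K$ and $\iota_{R_K}(X)=+\infty$ otherwise. For an extended-real-valued functional $f$ on $\mathbb{M}_{n_1,n_2}$ put $\mathcal{S}_2(f)(Y)=\sup_X\big(-f(X)-\|X-Y\|^2\big)$, and let $\mathcal{Q}_2(f)=\mathcal{S}_2(\mathcal{S}_2(f))$ be its quadratic envelope. Consider $$\mathcal{R}_{K,reg}(X)=\mathcal{Q}_2(\iota_{R_K})(X)+\|\mathcal{A}X-b\|^2 .$$ A point $X$ is called stationary for a functional $g$ if $$\liminf_{Y\to X,\;Y\ne X}\frac{g(Y)-g(X)}{\|Y-X\|}\ge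 0 .$$ Define $\delta_{2K}^-$ by $$1-\delta_{2K}^-=\inf\left\{\frac{\|\mathcal{A}X\|^2}{\|X\|^2}:\ X\neq 0,\ \operatorname{rank}(X)\le 2K\right\},$$ and let $\sigma_1(Z)\ge\sigma_2(Z)\ge\cdots$ be the singular values of a matrix $Z$, with $\sigma_j(Z)=0$ for $j>\min(n_1,n_2)$. **Theorem.** Let $X'$ be a stationary point of $\mathcal{R}_{K,reg}$ with $\operatorname{rank}(X')\le K$, and set $Z'=(I-\mathcal{A}^*\mathcal{A})X'+\mathcal{A}^*b$. If $$\sigma_{K+1}(Z')<(1-2\delta_{2K}^-)\,\sigma_K(Z'),$$ then $\mathcal{R}_{K,reg}$ has no other stationary point of rank at most $K$: every stationary point $X''$ of $\mathcal{R}_{K,reg}$ with $\operatorname{rank}(X'')\le K$ equals $X'$. -/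

import Mathlib

open Filter Topology

attribute [local instance] Matrix.frobeniusNormedAddCommGroup Matrix.frobeniusNormedSpace

/-- The space of `n₁ × n₂` matrices over `𝕜` (`ℝ` or `ℂ`), equipped with the Frobenius norm, is a
real inner product space for the real Frobenius inner product `Re tr (Xᴴ Y)`. -/
noncomputable instance frobeniusInnerProductSpace {𝕜 : Type*} [RCLike 𝕜] {n₁ n₂ : ℕ} :
    InnerProductSpace ℝ (Matrix (Fin n₁) (Fin n₂) 𝕜) where
  toNormedSpace := Matrix.frobeniusNormedSpace
  inner X Y := RCLike.re (X.conjTranspose * Y).trace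
  norm_sq_eq_re_inner X := by
    rw [Matrix.frobenius_norm_def, ← Real.sqrt_eq_rpow, Real.sq_sqrt (by positivity)]
    simp only [Matrix.trace, Matrix.diag_apply, Matrix.mul_apply, Matrix.conjTranspose_apply,
      RCLike.star_def, RCLike.conj_mul, map_sum, Real.rpow_two, RCLike.re_to_real]
    rw [Finset.sum_comm]
    refine Finset.sum_congr rfl fun j _ => Finset.sum_congr rfl fun i _ => ?_
    rw [← RCLike.ofReal_pow, RCLike.ofReal_re]
  conj_inner_symm X Y := by
    have h : (Y.conjTranspose * X).trace = star (X.conjTranspose * Y).trace := by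
      rw [← Matrix.trace_conjTranspose, Matrix.conjTranspose_mul, Matrix.conjTranspose_conjTranspose]
    simp [h]
  add_left X Y Z := by simp [Matrix.add_mul]
  smul_left X Y r := by
    simp [Matrix.conjTranspose_smul, RCLike.smul_re]

/-- The transform `S_γ(f)(Y) = sup_X (-f(X) - γ/2 ‖X - Y‖²)`. -/
noncomputable def sTransform {V : Type*} [NormedAddCommGroup V] (γ : ℝ) (f : V → EReal) :
    V → EReal :=
  fun Y => ⨆ X : V, (-f X - ((γ / 2 * ‖X - Y‖ ^ 2 : ℝ) : EReal))

/-- The quadratic envelope `Q_γ(f) = S_γ(S_γ(f))`. -/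
noncomputable def quadraticEnvelope {V : Type*} [NormedAddCommGroup V] (γ : ℝ) (f : V → EReal) :
    V → EReal :=
  sTransform γ (sTransform γ f)

/-- `X` is a stationary point of the extended-real-valued functional `g` if
`liminf_{Y → X, Y ≠ X} (g(Y) - g(X)) / ‖Y - X‖ ≥ 0`. -/
def IsStationaryPoint {V : Type*} [NormedAddCommGroup V] (g : V → EReal) (X : V) : Prop :=
  0 ≤ liminf (fun Y => (g Y - g X) / ((‖Y - X‖ : ℝ) : EReal)) (𝓝[≠] X)

/-- The indicator functional of the set of matrices of rank at most `K`: it is `0` on this set and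
`∞` elsewhere. -/
noncomputable def rankIndicator {𝕜 : Type*} [RCLike 𝕜] {n₁ n₂ : ℕ} (K : ℕ) :
    Matrix (Fin n₁) (Fin n₂) 𝕜 → EReal :=
  fun X => if X.rank ≤ K then 0 else ⊤

/-- The regularized functional `Q_2(ι_{rank ≤ K})(X) + ‖A X - b‖²`. -/
noncomputable def regularizedFunctional {𝕜 : Type*} [RCLike 𝕜] {n₁ n₂ : ℕ}
    {F : Type*} [NormedAddCommGroup F] [InnerProductSpace ℝ F]
    (A : Matrix (Fin n₁) (Fin n₂) 𝕜 →ₗ[ℝ] F) (b : F) (K : ℕ) :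
    Matrix (Fin n₁) (Fin n₂) 𝕜 → EReal :=
  fun X => quadraticEnvelope 2 (rankIndicator K) X + ((‖A X - b‖ ^ 2 : ℝ) : EReal)

/-- The lower restricted isometry constant `δ_K⁻` of `A`, given by
`1 - δ_K⁻ = inf {‖A X‖² / ‖X‖² : X ≠ 0, rank X ≤ K}`. -/
noncomputable def lrip {𝕜 : Type*} [RCLike 𝕜] {n₁ n₂ : ℕ}
    {F : Type*} [NormedAddCommGroup F] [InnerProductSpace ℝ F]
    (A : Matrix (Fin n₁) (Fin n₂) 𝕜 →ₗ[ℝ] F) (K : ℕ) : ℝ :=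
  1 - sInf {t : ℝ | ∃ X : Matrix (Fin n₁) (Fin n₂) 𝕜,
    X ≠ 0 ∧ X.rank ≤ K ∧ t = ‖A X‖ ^ 2 / ‖X‖ ^ 2}

/-- The `j`-th largest singular value of a matrix, for `j = 1, 2, …` (so the largest is `j = 1`);
it is `0` for `j > min n₁ n₂`. Mathlib's sequence of singular values starts at index `0`. -/
noncomputable def singularValue {𝕜 : Type*} [RCLike 𝕜] {n₁ n₂ : ℕ} (j : ℕ)
    (X : Matrix (Fin n₁) (Fin n₂) 𝕜) : ℝ :=
  (Matrix.toEuclideanLin X).singularValues (j - 1)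

/-- The point `Z = (I - A* A) X + A* b`, with `A*` the adjoint of `A` for the Frobenius inner
product. -/
noncomputable def dualPoint {𝕜 : Type*} [RCLike 𝕜] {n₁ n₂ : ℕ}
    {F : Type*} [NormedAddCommGroup F] [InnerProductSpace ℝ F] [FiniteDimensional ℝ F]
    (A : Matrix (Fin n₁) (Fin n₂) 𝕜 →ₗ[ℝ] F) (b : F) (X : Matrix (Fin n₁) (Fin n₂) 𝕜) :
    Matrix (Fin n₁) (Fin n₂) 𝕜 :=
  (X - LinearMap.adjoint A (A X)) + LinearMap.adjoint A b

/-! ### First-order conditions for the quadratic envelope -/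

section Stationarity

variable {V : Type*} [NormedAddCommGroup V]

/-! On a segment between two matrices of rank at most `K` the envelope is at most the convexity
defect of the squared norm. The one-sided derivative at a stationary point `X` therefore shows that
`X` is a best rank-`K` approximation of its dual point
(`IsStationaryPoint.norm_sub_dualPoint_sq_le`).

For `X'` this improves to quadratic growth with constant `1 - s/σ`, where `σ` and `s` are the
singular values of `Z'` of index `K` and `K + 1` (`IsStationaryPoint.quadratic_growth`); for `X''`
plain minimality suffices. With `D = X'' - X'`, adding the two and using
`norm_sub_dualPoint_sq_exchange` gives `(1 - s/σ)‖D‖² ≤ 2(‖D‖² - ‖A D‖²)`. As `D` has rank at most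
`2K`, the right side is at most `2δ‖D‖²`, which the gap hypothesis `s/σ < 1 - 2δ` forbids unless `D
= 0`. -/

lemma sTransform_nonpos {γ : ℝ} (hγ : 0 ≤ γ) {f : V → EReal} (hf : ∀ x, 0 ≤ f x) (y : V) :
    sTransform γ f y ≤ 0 := by
  refine iSup_le fun x => ?_
  have h1 : -f x ≤ 0 := by simpa using hf x
  have h2 : (0 : EReal) ≤ ((γ / 2 * ‖x - y‖ ^ 2 : ℝ) : EReal) := by
    exact_mod_cast (by positivity : (0 : ℝ) ≤ γ / 2 * ‖x - y‖ ^ 2)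
  simpa using EReal.sub_le_sub h1 h2

lemma quadraticEnvelope_nonneg {γ : ℝ} (hγ : 0 ≤ γ) {f : V → EReal} (hf : ∀ x, 0 ≤ f x) (x : V) :
    0 ≤ quadraticEnvelope γ f x := by
  refine le_trans ?_ (le_iSup _ x)
  simpa using sTransform_nonpos hγ hf x

lemma neg_sTransform_le {γ : ℝ} {f : V → EReal} {x : V} (hx : f x = 0) (v : V) :
    -sTransform γ f v ≤ ((γ / 2 * ‖x - v‖ ^ 2 : ℝ) : EReal) := by
  rw [EReal.neg_le]
  refine le_trans ?_ (le_iSup _ x)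
  simp [hx]

lemma norm_sq_segment [InnerProductSpace ℝ V] (p q : V) (t : ℝ) :
    ‖p + t • (q - p)‖ ^ 2 = (1 - t) * ‖p‖ ^ 2 + t * ‖q‖ ^ 2 - t * (1 - t) * ‖q - p‖ ^ 2 := by
  rw [norm_add_sq_real, norm_sub_sq_real, norm_smul, mul_pow, norm_sub_sq_real, inner_smul_right,
    inner_sub_right, real_inner_self_eq_norm_sq, real_inner_comm q p, Real.norm_eq_abs, sq_abs]
  ring

/-- On a segment between two zeros of `f`, the quadratic envelope is bounded by the defect of
convexity of the square of the norm. -/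
lemma quadraticEnvelope_segment_le [InnerProductSpace ℝ V] {f : V → EReal} {x y : V}
    (hx : f x = 0) (hy : f y = 0) {t : ℝ} (ht0 : 0 ≤ t) (ht1 : t ≤ 1) :
    quadraticEnvelope 2 f (x + t • (y - x)) ≤ ((t * (1 - t) * ‖y - x‖ ^ 2 : ℝ) : EReal) := by
  refine iSup_le fun v => ?_
  have h1 := neg_sTransform_le (γ := 2) hx v
  have h2 := neg_sTransform_le (γ := 2) hy v
  -- The minimum of two numbers is at most any convex combination of them; the weights are those of
  -- the point on the segment.
  have h3 : -sTransform 2 f v ≤ (((1 - t) * ‖x - v‖ ^ 2 + t * ‖y - v‖ ^ 2 : ℝ) : EReal) := by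
    rcases le_total (‖x - v‖ ^ 2) (‖y - v‖ ^ 2) with h | h
    · refine h1.trans ?_
      norm_cast
      nlinarith
    · refine h2.trans ?_
      norm_cast
      nlinarith
  have h4 := norm_sq_segment (x - v) (y - v) t
  have h5 : x - v + t • (y - v - (x - v)) = x + t • (y - x) - v := by
    rw [sub_sub_sub_cancel_right]; abel
  rw [h5, sub_sub_sub_cancel_right, norm_sub_rev] at h4
  refine (EReal.sub_le_sub h3 le_rfl).trans ?_
  rw [← EReal.coe_sub, EReal.coe_le_coe_iff, h4]
  linarith

/-- First-order condition along a ray at a stationary point. -/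
lemma IsStationaryPoint.nonneg_of_ray_le [NormedSpace ℝ V] {g : V → EReal} {x d : V} {a c : ℝ}
    (hg : IsStationaryPoint g x) (hd : d ≠ 0)
    (hle : ∀ t : ℝ, 0 < t → t ≤ 1 → g (x + t • d) - g x ≤ ((t * a + t ^ 2 * c : ℝ) : EReal)) :
    0 ≤ a := by
  by_contra! ha
  have hdn : 0 < ‖d‖ := norm_pos_iff.2 hd
  -- The quotient along the ray is at most `(a + t * c) / ‖d‖`, which drops below this negative
  -- threshold once `t * c < -a / 2`.
  have hlt : ((a / 2 / ‖d‖ : ℝ) : EReal) < liminf (fun y => (g y - g x) / ((‖y - x‖ : ℝ) : EReal))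
      (𝓝[≠] x) := by
    refine lt_of_lt_of_le ?_ hg
    exact_mod_cast div_neg_of_neg_of_pos (by linarith) hdn
  have hev := eventually_lt_of_lt_liminf hlt
  have hpath : Tendsto (fun t : ℝ => x + t • d) (𝓝[>] 0) (𝓝[≠] x) := by
    refine tendsto_nhdsWithin_iff.2 ⟨?_, ?_⟩
    · have : Tendsto (fun t : ℝ => x + t • d) (𝓝 0) (𝓝 (x + (0 : ℝ) • d)) :=
        Continuous.tendsto (by fun_prop) 0
      rw [zero_smul, add_zero] at this
      exact this.mono_left nhdsWithin_le_nhds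
    · filter_upwards [self_mem_nhdsWithin] with t ht
      simpa [hd] using ne_of_gt ht
  have hsmall : ∀ᶠ t : ℝ in 𝓝[>] 0, t * c < -a / 2 := by
    have : Tendsto (fun t : ℝ => t * c) (𝓝 0) (𝓝 (0 * c)) := Continuous.tendsto (by fun_prop) 0
    rw [zero_mul] at this
    exact (this.mono_left nhdsWithin_le_nhds).eventually (gt_mem_nhds (by linarith))
  have hone : ∀ᶠ t : ℝ in 𝓝[>] 0, t ≤ 1 :=
    nhdsWithin_le_nhds (Iic_mem_nhds one_pos)
  have hgt : ∀ᶠ t : ℝ in 𝓝[>] 0, 0 < t := self_mem_nhdsWithin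
  obtain ⟨t, ht0, hq, hs, ht1⟩ :=
    (hgt.and ((hpath.eventually hev).and (hsmall.and hone))).exists
  have hn : ‖x + t • d - x‖ = t * ‖d‖ := by
    rw [add_sub_cancel_left, norm_smul, Real.norm_of_nonneg ht0.le]
  have hpos : 0 < t * ‖d‖ := by positivity
  rw [hn] at hq
  have hq' := hq.trans_le (EReal.div_le_div_right_of_nonneg (by exact_mod_cast hpos.le)
    (hle t ht0 ht1))
  rw [← EReal.coe_div, EReal.coe_lt_coe_iff, div_lt_div_iff₀ hdn hpos] at hq'
  have : a / 2 * t < t * a + t ^ 2 * c := by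
    by_contra! hcon
    nlinarith
  nlinarith

/-- At a stationary point `x` of `Q₂(f) + ‖A · - b‖²` with `f x = 0`, the point `x` is a nearest
zero of `f` to `x - A* (A x - b)`. -/
lemma IsStationaryPoint.envelope_add_variational [InnerProductSpace ℝ V] {F : Type*}
    [NormedAddCommGroup F] [InnerProductSpace ℝ F] {A : V →ₗ[ℝ] F} {b : F} {f : V → EReal}
    (hf : ∀ v, 0 ≤ f v) {x : V}
    (hst : IsStationaryPoint
      (fun v => quadraticEnvelope 2 f v + ((‖A v - b‖ ^ 2 : ℝ) : EReal)) x)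
    (hx : f x = 0) {y : V} (hy : f y = 0) :
    0 ≤ ‖y - x‖ ^ 2 + 2 * inner ℝ (A x - b) (A (y - x)) := by
  rcases eq_or_ne y x with rfl | hne
  · simp
  refine hst.nonneg_of_ray_le (d := y - x) (c := ‖A (y - x)‖ ^ 2 - ‖y - x‖ ^ 2)
    (sub_ne_zero.2 hne) fun t ht0 ht1 => ?_
  have hup := quadraticEnvelope_segment_le hx hy ht0.le ht1
  have hlow : ((‖A x - b‖ ^ 2 : ℝ) : EReal) ≤
      quadraticEnvelope 2 f x + ((‖A x - b‖ ^ 2 : ℝ) : EReal) :=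
    le_add_of_nonneg_left (quadraticEnvelope_nonneg zero_le_two hf x)
  refine (EReal.sub_le_sub (add_le_add hup le_rfl) hlow).trans ?_
  rw [← EReal.coe_add, ← EReal.coe_sub, EReal.coe_le_coe_iff]
  have h : A (x + t • (y - x)) - b = (A x - b) + t • A (y - x) := by
    rw [map_add, map_smul]; abel
  rw [h, norm_add_sq_real, inner_smul_right, norm_smul, mul_pow, Real.norm_eq_abs, sq_abs]
  apply le_of_eq
  ring

end Stationarity

/-! ### Eckart–Young with quadratic growth, for linear maps -/

section LowRankApproximation

open Module

variable {𝕜 E G : Type*} [RCLike 𝕜] [NormedAddCommGroup E] [InnerProductSpace 𝕜 E]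
  [NormedAddCommGroup G] [InnerProductSpace 𝕜 G]

lemma norm_sq_apply_of_pairwise_orthogonal {ι : Type*} [Fintype ι] (v : OrthonormalBasis ι 𝕜 E)
    {T : E →ₗ[𝕜] G} (hT : Pairwise fun i j => inner 𝕜 (T (v i)) (T (v j)) = 0) (x : E) :
    ‖T x‖ ^ 2 = ∑ i, ‖T (v i)‖ ^ 2 * ‖inner 𝕜 (v i) x‖ ^ 2 := by
  classical
  have hx : T x = ∑ i, inner 𝕜 (v i) x • T (v i) := by
    conv_lhs => rw [← v.sum_repr' x]
    simp
  rw [← RCLike.ofReal_inj (K := 𝕜), RCLike.ofReal_pow, ← inner_self_eq_norm_sq_to_K (𝕜 := 𝕜), hx,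
    sum_inner]
  push_cast
  refine Finset.sum_congr rfl fun i _ => ?_
  rw [inner_sum, Finset.sum_eq_single i]
  · rw [inner_smul_left, inner_smul_right, inner_self_eq_norm_sq_to_K, ← mul_assoc,
      RCLike.conj_mul]
    ring
  · intro j _ hj
    rw [inner_smul_left, inner_smul_right, hT hj.symm]
    simp
  · simp

variable [FiniteDimensional 𝕜 E] [FiniteDimensional 𝕜 G]

/-- The sum of `‖S w‖²` over an orthonormal family is at most the squared Hilbert–Schmidt norm. -/
lemma Orthonormal.sum_norm_sq_apply_le {ι κ : Type*} [Fintype ι] [Fintype κ] {w : κ → E}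
    (hw : Orthonormal 𝕜 w) (v : OrthonormalBasis ι 𝕜 E) (S : E →ₗ[𝕜] G) :
    ∑ k, ‖S (w k)‖ ^ 2 ≤ ∑ i, ‖S (v i)‖ ^ 2 := by
  let e := stdOrthonormalBasis 𝕜 G
  -- Moving `S` to the adjoint reduces the claim to Bessel for `w` against Parseval for `v`.
  have hS : ∀ x, ‖S x‖ ^ 2 = ∑ j, ‖inner 𝕜 x (LinearMap.adjoint S (e j))‖ ^ 2 := fun x => by
    rw [← e.sum_sq_norm_inner_left]
    simp_rw [LinearMap.adjoint_inner_right]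
  simp_rw [hS]
  rw [Finset.sum_comm, Finset.sum_comm (s := (Finset.univ : Finset ι))]
  refine Finset.sum_le_sum fun j _ => ?_
  rw [v.sum_sq_norm_inner_right]
  exact hw.sum_inner_products_le _

/-- The Eckart–Young lower bound for a map that sends an orthonormal basis to orthogonal vectors
whose lengths are at least `σ` before the index `K`, and at most `σ` from it on. -/
lemma sum_norm_sq_le_of_finrank_range_le {n K : ℕ} (v : OrthonormalBasis (Fin n) 𝕜 E)
    {T Y : E →ₗ[𝕜] G} (hT : Pairwise fun i j => inner 𝕜 (T (v i)) (T (v j)) = 0) {σ : ℝ}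
    (hσ : 0 ≤ σ) (hlarge : ∀ i : Fin n, i.val < K → σ ≤ ‖T (v i)‖)
    (hsmall : ∀ i : Fin n, K ≤ i.val → ‖T (v i)‖ ≤ σ) (hY : finrank 𝕜 Y.range ≤ K) :
    ∑ i : Fin n, (if i.val < K then 0 else ‖T (v i)‖ ^ 2) ≤ ∑ i, ‖Y (v i) - T (v i)‖ ^ 2 := by
  -- On the kernel of `Y` the difference `Y - T` is `-T`, so its Hilbert–Schmidt norm there depends
  -- on `T` alone.
  let w := stdOrthonormalBasis 𝕜 Y.ker
  have hw : Orthonormal 𝕜 (fun k => (w k : E)) :=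
    w.orthonormal.comp_linearIsometry Y.ker.subtypeₗᵢ
  have h1 := hw.sum_norm_sq_apply_le v (Y - T)
  have h2 : ∀ k, ‖(Y - T) (w k : E)‖ ^ 2 = ∑ i, ‖T (v i)‖ ^ 2 * ‖inner 𝕜 (v i) (w k : E)‖ ^ 2 := by
    intro k
    rw [← norm_sq_apply_of_pairwise_orthogonal v hT, LinearMap.sub_apply,
      LinearMap.mem_ker.1 (w k).2, zero_sub, norm_neg]
  simp_rw [h2] at h1
  rw [Finset.sum_comm] at h1
  simp_rw [← Finset.mul_sum] at h1
  simp only [LinearMap.sub_apply] at h1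
  refine le_trans ?_ h1
  set ω : Fin n → ℝ := fun i => ∑ k, ‖inner 𝕜 (v i) (w k : E)‖ ^ 2 with hω
  have hω0 : ∀ i, 0 ≤ ω i := fun i => Finset.sum_nonneg fun k _ => by positivity
  have hω1 : ∀ i, ω i ≤ 1 := fun i => by
    have := hw.sum_inner_products_le (v i) (s := Finset.univ)
    simp_rw [v.norm_eq_one, one_pow] at this
    simp_rw [hω, norm_inner_symm (v i)]
    exact this
  have hωsum : ∑ i, ω i = finrank 𝕜 Y.ker := by
    simp_rw [hω]
    rw [Finset.sum_comm]
    simp_rw [v.sum_sq_norm_inner_right, hw.1]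
    simp
  have hcard : ∑ i : Fin n, (if i.val < K then (0 : ℝ) else 1) ≤ finrank 𝕜 Y.ker := by
    have hn : finrank 𝕜 E = n := by simpa using finrank_eq_card_basis v.toBasis
    have h3 := Y.finrank_range_add_finrank_ker
    have h4 : n ≤ K + finrank 𝕜 Y.ker := by omega
    have h5 : ∑ i : Fin n, (if i.val < K then (0 : ℝ) else 1) = ((n - K : ℕ) : ℝ) := by
      rw [Fin.sum_univ_eq_sum_range (fun i => if i < K then (0 : ℝ) else 1)]
      clear * -
      induction n with
      | zero => simp
      | succ n ih =>
        rw [Finset.sum_range_succ, ih]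
        split_ifs with h
        · rw [Nat.sub_eq_zero_of_le h.le, Nat.sub_eq_zero_of_le h]; simp
        · rw [Nat.succ_sub (not_lt.1 h)]; simp
    rw [h5]
    exact_mod_cast (by omega : n - K ≤ finrank 𝕜 Y.ker)
  -- The weights `ω` lie in `[0, 1]` and have total at least `n - K`; the weighted sum is smallest
  -- when they sit on the tail, and `σ ^ 2` acts as the multiplier.
  have hterm : ∀ i : Fin n, σ ^ 2 * (ω i - if i.val < K then 0 else 1) ≤
      ‖T (v i)‖ ^ 2 * ω i - if i.val < K then 0 else ‖T (v i)‖ ^ 2 := by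
    intro i
    split_ifs with h
    · have := pow_le_pow_left₀ hσ (hlarge i h) 2
      nlinarith [hω0 i]
    · have := pow_le_pow_left₀ (norm_nonneg _) (hsmall i (not_lt.1 h)) 2
      nlinarith [hω1 i]
  have hsum := Finset.sum_le_sum fun i (_ : i ∈ Finset.univ) => hterm i
  rw [← Finset.mul_sum, Finset.sum_sub_distrib, Finset.sum_sub_distrib, hωsum] at hsum
  nlinarith [mul_nonneg (sq_nonneg σ) (sub_nonneg.2 hcard)]

/-- Quadratic growth of the distance to `T`, on the maps of rank at most `K`, around the truncation
of `T` to the first `K` vectors of an orthonormal basis of right singular vectors. -/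
lemma sum_norm_sq_growth {n K : ℕ} (v : OrthonormalBasis (Fin n) 𝕜 E)
    {T X Y : E →ₗ[𝕜] G} (hT : Pairwise fun i j => inner 𝕜 (T (v i)) (T (v j)) = 0) {s σ : ℝ}
    (hs : 0 ≤ s) (hσ : 0 < σ) (hlarge : ∀ i : Fin n, i.val < K → σ ≤ ‖T (v i)‖)
    (hsmall : ∀ i : Fin n, K ≤ i.val → ‖T (v i)‖ ≤ s)
    (hX : ∀ i : Fin n, X (v i) = if i.val < K then T (v i) else 0)
    (hY : finrank 𝕜 Y.range ≤ K) :
    (1 - s / σ) * ∑ i, ‖Y (v i) - X (v i)‖ ^ 2 ≤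
      ∑ i, ‖Y (v i) - T (v i)‖ ^ 2 - ∑ i, ‖X (v i) - T (v i)‖ ^ 2 := by
  rcases hs.eq_or_lt with rfl | hs
  · have hXT : ∀ i, X (v i) = T (v i) := fun i => by
      rw [hX]
      split_ifs with h
      · rfl
      · exact (norm_le_zero_iff.1 (hsmall i (not_lt.1 h))).symm
    simp [hXT]
  -- Stretching the tail by `σ / s` keeps it at most `σ`, so Eckart–Young still applies to `U`. Its
  -- inequality times `s / σ` is exactly the claim.
  let c : Fin n → ℝ := fun i => if i.val < K then 1 else σ / s
  let U : E →ₗ[𝕜] G := v.toBasis.constr 𝕜 fun i => (c i : 𝕜) • T (v i)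
  have hU : ∀ i, U (v i) = (c i : 𝕜) • T (v i) := fun i => by
    have := v.toBasis.constr_basis 𝕜 (fun i => (c i : 𝕜) • T (v i)) i
    rwa [v.coe_toBasis] at this
  have hUn : ∀ i, ‖U (v i)‖ = c i * ‖T (v i)‖ := fun i => by
    rw [hU, norm_smul, RCLike.norm_ofReal, abs_of_nonneg]
    simp only [c]; split_ifs <;> positivity
  have key := sum_norm_sq_le_of_finrank_range_le v (T := U) (Y := Y) (σ := σ) (K := K)
    (fun i j hij => by simp [hU, inner_smul_left, inner_smul_right, hT hij]) hσ.le
    (fun i hi => by simpa [hUn, c, hi] using hlarge i hi)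
    (fun i hi => by
      rw [hUn]
      simp only [c, not_lt.2 hi, if_false]
      calc σ / s * ‖T (v i)‖ ≤ σ / s * s := by gcongr; exact hsmall i hi
        _ = σ := by field_simp) hY
  rw [← sub_nonneg, ← Finset.sum_sub_distrib] at key
  rw [← sub_nonneg, Finset.mul_sum, ← Finset.sum_sub_distrib, ← Finset.sum_sub_distrib]
  have hc : 0 ≤ s / σ := by positivity
  refine (mul_nonneg hc key).trans (le_of_eq ?_)
  rw [Finset.mul_sum]
  refine Finset.sum_congr rfl fun i _ => ?_
  rw [hUn, hU, hX]
  simp only [c]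
  split_ifs with h
  · simp; ring
  · simp only [sub_zero, zero_sub, norm_neg]
    rw [@norm_sub_sq 𝕜, @norm_sub_sq 𝕜, inner_smul_right, RCLike.re_ofReal_mul, norm_smul,
      RCLike.norm_ofReal, abs_of_nonneg (by positivity : 0 ≤ σ / s)]
    field_simp
    ring

end LowRankApproximation

/-! ### Transfer to matrices and singular values -/

section MatrixApproximation

open Module

variable {𝕜 : Type*} [RCLike 𝕜] {n₁ n₂ : ℕ}

/-- The trace of `Xᴴ * X` can be computed in any orthonormal basis, in particular one of right
singular vectors. -/
lemma Matrix.frobenius_norm_sq_eq_sum {ι : Type*} [Fintype ι]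
    (v : OrthonormalBasis ι 𝕜 (EuclideanSpace 𝕜 (Fin n₂))) (X : Matrix (Fin n₁) (Fin n₂) 𝕜) :
    ‖X‖ ^ 2 = ∑ i, ‖Matrix.toEuclideanLin X (v i)‖ ^ 2 := by
  have h1 : ‖X‖ ^ 2 = RCLike.re (X.conjTranspose * X).trace := by
    rw [← real_inner_self_eq_norm_sq]; rfl
  have h2 : Matrix.toEuclideanLin (X.conjTranspose * X) =
      LinearMap.adjoint (Matrix.toEuclideanLin X) ∘ₗ Matrix.toEuclideanLin X := by
    rw [← Matrix.toEuclideanLin_conjTranspose_eq_adjoint]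
    exact Matrix.toLpLin_mul_same 2 _ _
  have h3 : LinearMap.trace 𝕜 _ (Matrix.toEuclideanLin (X.conjTranspose * X)) =
      (X.conjTranspose * X).trace := by
    rw [Matrix.toEuclideanLin, Matrix.toLpLin_eq_toLin, Matrix.trace_toLin_eq]
  rw [h1, ← h3, h2, LinearMap.trace_eq_sum_inner _ v, map_sum]
  refine Finset.sum_congr rfl fun i _ => ?_
  rw [LinearMap.comp_apply, LinearMap.adjoint_inner_right, inner_self_eq_norm_sq]

lemma Matrix.rank_eq_finrank_range_toEuclideanLin (X : Matrix (Fin n₁) (Fin n₂) 𝕜) :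
    X.rank = finrank 𝕜 (Matrix.toEuclideanLin X).range := by
  rw [Matrix.toEuclideanLin, Matrix.toLpLin_eq_toLin]
  exact X.rank_eq_finrank_range_toLin _ _

/-- Quadratic growth of the Frobenius distance to `Z` on the matrices of rank at most `K`, around a
best approximation. -/
lemma Matrix.exists_quadratic_growth (Z : Matrix (Fin n₁) (Fin n₂) 𝕜) {K : ℕ} (hK : 1 ≤ K)
    (hσ : 0 < singularValue K Z) :
    ∃ X : Matrix (Fin n₁) (Fin n₂) 𝕜, X.rank ≤ K ∧
      ∀ Y : Matrix (Fin n₁) (Fin n₂) 𝕜, Y.rank ≤ K →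
        (1 - singularValue (K + 1) Z / singularValue K Z) * ‖Y - X‖ ^ 2 ≤
          ‖Y - Z‖ ^ 2 - ‖X - Z‖ ^ 2 := by
  set T := Matrix.toEuclideanLin Z with hT
  have hn : finrank 𝕜 (EuclideanSpace 𝕜 (Fin n₂)) = n₂ := finrank_euclideanSpace_fin
  let v := T.isSymmetric_adjoint_comp_self.eigenvectorBasis hn
  have hinner : ∀ i j, inner 𝕜 (T (v i)) (T (v j)) =
      (T.isSymmetric_adjoint_comp_self.eigenvalues hn j : 𝕜) * inner 𝕜 (v i) (v j) := by
    intro i j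
    rw [← LinearMap.adjoint_inner_right, ← LinearMap.comp_apply,
      T.isSymmetric_adjoint_comp_self.apply_eigenvectorBasis hn j, inner_smul_right]
  have horth : Pairwise fun i j => inner 𝕜 (T (v i)) (T (v j)) = 0 := fun i j hij => by
    beta_reduce
    rw [hinner, v.orthonormal.2 hij, mul_zero]
  have hnorm : ∀ i : Fin n₂, ‖T (v i)‖ = T.singularValues i := fun i => by
    rw [← sq_eq_sq₀ (norm_nonneg _) (T.singularValues_nonneg _), T.sq_singularValues_fin hn,
      ← RCLike.ofReal_inj (K := 𝕜), RCLike.ofReal_pow, ← inner_self_eq_norm_sq_to_K (𝕜 := 𝕜),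
      hinner, inner_self_eq_norm_sq_to_K, v.norm_eq_one]
    simp
  let X : EuclideanSpace 𝕜 (Fin n₂) →ₗ[𝕜] EuclideanSpace 𝕜 (Fin n₁) :=
    v.toBasis.constr 𝕜 fun i => if i.val < K then T (v i) else 0
  have hX : ∀ i, X (v i) = if i.val < K then T (v i) else 0 := fun i => by
    have := v.toBasis.constr_basis 𝕜 (fun i => if i.val < K then T (v i) else 0) i
    rwa [v.coe_toBasis] at this
  have hXrank : finrank 𝕜 X.range ≤ K := by
    classical
    let I : Finset (Fin n₂) := Finset.univ.filter fun i => i.val < K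
    have hI : I.card ≤ K := by
      have : I.card ≤ (Finset.range K).card :=
        Finset.card_le_card_of_injOn Fin.val (fun i hi => by simpa [I] using hi)
          (Fin.val_injective.injOn)
      simpa using this
    have hle : X.range ≤ Submodule.span 𝕜 (I.image fun i => T (v i) : Finset _) := by
      rw [Basis.constr_range, Submodule.span_le]
      rintro _ ⟨i, rfl⟩
      dsimp only
      split_ifs with h
      · exact Submodule.subset_span (Finset.mem_coe.2 (Finset.mem_image_of_mem _ (by simpa [I])))
      · exact Submodule.zero_mem _
    exact (Submodule.finrank_mono hle).trans
      ((finrank_span_finset_le_card _).trans (Finset.card_image_le.trans hI))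
  refine ⟨Matrix.toEuclideanLin.symm X, ?_, fun Y hY => ?_⟩
  · rwa [Matrix.rank_eq_finrank_range_toEuclideanLin, LinearEquiv.apply_symm_apply]
  · rw [Matrix.rank_eq_finrank_range_toEuclideanLin] at hY
    simp only [Matrix.frobenius_norm_sq_eq_sum v, map_sub, LinearMap.sub_apply,
      LinearEquiv.apply_symm_apply]
    refine sum_norm_sq_growth v horth (T.singularValues_nonneg _) hσ (fun i hi => ?_)
      (fun i hi => ?_) hX hY
    · rw [hnorm]
      exact T.singularValues_antitone (by omega)
    · rw [hnorm]
      exact T.singularValues_antitone (by simpa using hi)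

end MatrixApproximation

/-! ### Uniqueness of the low-rank stationary point -/

section Uniqueness

variable {𝕜 : Type*} [RCLike 𝕜] {n₁ n₂ : ℕ} {F : Type*} [NormedAddCommGroup F]
  [InnerProductSpace ℝ F]

lemma one_sub_lrip_mul_norm_sq_le (A : Matrix (Fin n₁) (Fin n₂) 𝕜 →ₗ[ℝ] F) {K : ℕ}
    {X : Matrix (Fin n₁) (Fin n₂) 𝕜} (hX : X.rank ≤ K) :
    (1 - lrip A K) * ‖X‖ ^ 2 ≤ ‖A X‖ ^ 2 := by
  rcases eq_or_ne X 0 with rfl | h0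
  · simp
  have hpos : 0 < ‖X‖ ^ 2 := by have := norm_pos_iff.2 h0; positivity
  rw [← le_div_iff₀ hpos, lrip, sub_sub_cancel]
  refine csInf_le ⟨0, ?_⟩ ⟨X, h0, hX, rfl⟩
  rintro _ ⟨Y, -, -, rfl⟩
  positivity

variable [FiniteDimensional ℝ F]

/-- A stationary point of rank at most `K` is a best approximation of its dual point among the
matrices of rank at most `K`. -/
lemma IsStationaryPoint.norm_sub_dualPoint_sq_le {A : Matrix (Fin n₁) (Fin n₂) 𝕜 →ₗ[ℝ] F} {b : F}
    {K : ℕ} {X Y : Matrix (Fin n₁) (Fin n₂) 𝕜}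
    (hst : IsStationaryPoint (regularizedFunctional A b K) X) (hX : X.rank ≤ K)
    (hY : Y.rank ≤ K) :
    ‖X - dualPoint A b X‖ ^ 2 ≤ ‖Y - dualPoint A b X‖ ^ 2 := by
  have hf : ∀ W : Matrix (Fin n₁) (Fin n₂) 𝕜, 0 ≤ rankIndicator K W := fun W => by
    unfold rankIndicator
    split_ifs <;> simp
  have h := IsStationaryPoint.envelope_add_variational hf hst (if_pos hX) (if_pos hY)
  have h1 : X - dualPoint A b X = LinearMap.adjoint A (A X - b) := by
    rw [dualPoint, map_sub]; abel
  have h2 : Y - dualPoint A b X = (Y - X) + LinearMap.adjoint A (A X - b) := by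
    rw [← h1]; abel
  rw [h1, h2, norm_add_sq_real, LinearMap.adjoint_inner_right, real_inner_comm]
  linarith

/-- Quadratic growth, around a stationary point of rank at most `K`, of the distance to its dual
point. -/
lemma IsStationaryPoint.quadratic_growth {A : Matrix (Fin n₁) (Fin n₂) 𝕜 →ₗ[ℝ] F} {b : F}
    {K : ℕ} (hK : 1 ≤ K) {X Y : Matrix (Fin n₁) (Fin n₂) 𝕜}
    (hst : IsStationaryPoint (regularizedFunctional A b K) X) (hX : X.rank ≤ K)
    (hσ : 0 < singularValue K (dualPoint A b X)) (hY : Y.rank ≤ K) :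
    (1 - singularValue (K + 1) (dualPoint A b X) / singularValue K (dualPoint A b X)) *
      ‖Y - X‖ ^ 2 ≤ ‖Y - dualPoint A b X‖ ^ 2 - ‖X - dualPoint A b X‖ ^ 2 := by
  have hanti : singularValue (K + 1) (dualPoint A b X) ≤ singularValue K (dualPoint A b X) :=
    LinearMap.singularValues_antitone _ (by omega)
  obtain ⟨X₀, hX₀, hgrowth⟩ := Matrix.exists_quadratic_growth (dualPoint A b X) hK hσ
  -- Without a gap the best approximation need not be unique, but the constant is then zero. With a
  -- gap, growth around `X₀` forces `X = X₀`.
  rcases hanti.eq_or_lt with heq | hlt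
  · rw [heq, div_self hσ.ne', sub_self, zero_mul]
    exact sub_nonneg.2 (hst.norm_sub_dualPoint_sq_le hX hY)
  · have h1 := hgrowth X hX
    have h2 := hst.norm_sub_dualPoint_sq_le hX hX₀
    have hc : 0 < 1 - singularValue (K + 1) (dualPoint A b X) / singularValue K (dualPoint A b X) :=
      sub_pos.2 ((div_lt_one hσ).2 hlt)
    have h3 : ‖X - X₀‖ ^ 2 ≤ 0 := by
      by_contra! hcon
      nlinarith [mul_pos hc hcon]
    have h4 : X = X₀ := by
      rw [← sub_eq_zero, ← norm_eq_zero]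
      exact pow_eq_zero_iff two_ne_zero |>.1 (le_antisymm h3 (sq_nonneg _))
    rw [← h4] at hgrowth
    exact hgrowth Y hY

/-- The change of the dual point tested against the change of the point. -/
lemma norm_sub_dualPoint_sq_exchange (A : Matrix (Fin n₁) (Fin n₂) 𝕜 →ₗ[ℝ] F) (b : F)
    (X Y : Matrix (Fin n₁) (Fin n₂) 𝕜) :
    (‖Y - dualPoint A b X‖ ^ 2 - ‖X - dualPoint A b X‖ ^ 2) +
      (‖X - dualPoint A b Y‖ ^ 2 - ‖Y - dualPoint A b Y‖ ^ 2) =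
      2 * (‖Y - X‖ ^ 2 - ‖A (Y - X)‖ ^ 2) := by
  have hdual : dualPoint A b Y - dualPoint A b X =
      (Y - X) - LinearMap.adjoint A (A (Y - X)) := by
    simp only [dualPoint, map_sub]; abel
  have h : inner ℝ (Y - X) (dualPoint A b Y - dualPoint A b X) =
      ‖Y - X‖ ^ 2 - ‖A (Y - X)‖ ^ 2 := by
    rw [hdual, inner_sub_right, LinearMap.adjoint_inner_right, real_inner_self_eq_norm_sq,
      real_inner_self_eq_norm_sq]
  rw [← h]
  simp only [norm_sub_sq_real, inner_sub_left, inner_sub_right]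
  ring

end Uniqueness

theorem theorem6p1 {𝕜 : Type*} [RCLike 𝕜] {n₁ n₂ : ℕ}
    {F : Type*} [NormedAddCommGroup F] [InnerProductSpace ℝ F] [FiniteDimensional ℝ F]
    (A : Matrix (Fin n₁) (Fin n₂) 𝕜 →ₗ[ℝ] F) (b : F) (K : ℕ) (hK : 1 ≤ K)
    (X' : Matrix (Fin n₁) (Fin n₂) 𝕜)
    (hX' : IsStationaryPoint (regularizedFunctional A b K) X')
    (hrank : X'.rank ≤ K)
    (hσ : singularValue (K + 1) (dualPoint A b X')
      < (1 - 2 * lrip A (2 * K)) * singularValue K (dualPoint A b X')) :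
    ∀ X'' : Matrix (Fin n₁) (Fin n₂) 𝕜,
      IsStationaryPoint (regularizedFunctional A b K) X'' → X''.rank ≤ K → X'' = X' := by
  intro X'' hX'' hrank''
  have hs0 : 0 ≤ singularValue (K + 1) (dualPoint A b X') := LinearMap.singularValues_nonneg _ _
  have hσ0 : 0 < singularValue K (dualPoint A b X') := by
    refine lt_of_le_of_ne (LinearMap.singularValues_nonneg _ _) fun h => ?_
    rw [← h, mul_zero] at hσ
    exact hσ.not_ge hs0
  have hgrowth := hX'.quadratic_growth hK hrank hσ0 hrank''
  have hmin := hX''.norm_sub_dualPoint_sq_le hrank'' hrank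
  have hexch := norm_sub_dualPoint_sq_exchange A b X' X''
  have hdiff : (X'' - X').rank ≤ 2 * K := by
    rw [Matrix.rank_eq_finrank_range_toEuclideanLin] at hrank hrank'' ⊢
    have hle : (Matrix.toEuclideanLin (X'' - X')).range ≤
        (Matrix.toEuclideanLin X'').range ⊔ (Matrix.toEuclideanLin X').range := by
      rintro _ ⟨x, rfl⟩
      rw [map_sub, LinearMap.sub_apply]
      exact Submodule.sub_mem _ (Submodule.mem_sup_left ⟨x, rfl⟩)
        (Submodule.mem_sup_right ⟨x, rfl⟩)
    have := (Submodule.finrank_mono hle).trans (Submodule.finrank_add_le_finrank_add_finrank _ _)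
    omega
  have hrip := one_sub_lrip_mul_norm_sq_le A hdiff
  have hc := (div_lt_iff₀ hσ0).2 hσ
  by_contra hne
  have hpos : 0 < ‖X'' - X'‖ ^ 2 := by
    have := norm_pos_iff.2 (sub_ne_zero.2 hne)
    positivity
  have := mul_lt_mul_of_pos_right hc hpos
  linarith
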